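/- Let $K$ be a field and let $E=(E^0,E^1,r,s)$ be an acyclic directed graph (i.e. one with no closed path of length at least one; $E^0$ and $E^1$ are arbitrary sets). The Leavitt path algebra $L_K(E)$ is the associative, not necessarily unital, $K$-algebra generated by $E^0\cup E^1\cup\{e^*\mid e\in E^1\}$ subject to the relations: $vv'=\delta_{v,v'}v$ for $v,v'\in E^0$; $s(e)e=er(e)=e$ and $r(e)e^*=e^*s(e)=e^*$ for $e\in E^1$; $e^*f=\delta_{e,f}r(e)$ for $e,f\in E^1$; and $v=\sum_{e\in s^{-1}(v)}ee^*$ for every $v\in E^0$ for which $s^{-1}(v)$ is finite and non-empty. Regard $L_K(E)$ as a Lie algebra over $K$ with bracket $[a,b]=ab-ba$. If $L_K(E)$ is locally Lie solvable, that is, every finite-dimensional Lie subalgebra of it is solvable, then $L_K(E)$ is Lie solvable, that is, it is a solvable Lie algebra: some term of its derived series is $0$. -/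

import Mathlib

universe u v w

/-- A directed graph `(E⁰, E¹, r, s)` with vertex set `V` and edge set `W`: two arbitrary sets
together with source and range maps (loops and parallel edges are allowed, and there is no
cardinality restriction). -/
structure DirectedGraph (V : Type u) (W : Type v) where
  /-- the source of an edge -/
  s : W → V
  /-- the range of an edge -/
  r : W → V

namespace DirectedGraph

variable {V : Type u} {W : Type v}

/-- A finite path of length at least one: a non-empty sequence of edges `e₁ e₂ … eₙ` with
`r(eᵢ) = s(eᵢ₊₁)`. -/
def IsPath (E : DirectedGraph V W) (p : List W) : Prop :=
  p ≠ [] ∧ p.IsChain (fun e f => E.r e = E.s f)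

/-- A closed path based at `v`: a finite path of length at least one which starts and ends
at `v`. -/
def IsClosedPath (E : DirectedGraph V W) (v : V) (p : List W) : Prop :=
  E.IsPath p ∧ (∀ e ∈ p.head?, E.s e = v) ∧ (∀ e ∈ p.getLast?, E.r e = v)

/-- A graph is acyclic if it has no closed path based at any vertex. -/
def Acyclic (E : DirectedGraph V W) : Prop :=
  ∀ (v : V) (p : List W), ¬ E.IsClosedPath v p

/-- A vertex is regular if it emits at least one and only finitely many edges. -/
def IsRegular (E : DirectedGraph V W) (v : V) : Prop :=
  (E.s ⁻¹' {v}).Nonempty ∧ (E.s ⁻¹' {v}).Finite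

end DirectedGraph

/-- The generators of a Leavitt path algebra: the vertices `v`, the edges `e`, and the ghost
edges `e*`. -/
inductive LeavittGen (V : Type u) (W : Type v) : Type (max u v)
  | vertex : V → LeavittGen V W
  | edge : W → LeavittGen V W
  | ghost : W → LeavittGen V W

/-- The free associative, not necessarily unital, `K`-algebra on the generators: the semigroup
algebra of the free semigroup. -/
abbrev FreeLeavitt (K : Type w) [Field K] (V : Type u) (W : Type v) : Type (max u v w) :=
  MonoidAlgebra K (FreeSemigroup (LeavittGen V W))

namespace FreeLeavitt

variable (K : Type w) [Field K] {V : Type u} {W : Type v}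

/-- A generator, as an element of the free algebra. -/
noncomputable def gen (x : LeavittGen V W) : FreeLeavitt K V W :=
  MonoidAlgebra.single (FreeSemigroup.of x) 1

/-- The generator belonging to a vertex. -/
noncomputable def vertex (v : V) : FreeLeavitt K V W := gen K (LeavittGen.vertex v)

/-- The generator belonging to an edge. -/
noncomputable def edge (e : W) : FreeLeavitt K V W := gen K (LeavittGen.edge e)

/-- The generator `e*` belonging to an edge `e`. -/
noncomputable def ghost (e : W) : FreeLeavitt K V W := gen K (LeavittGen.ghost e)

end FreeLeavitt

open FreeLeavitt in
/-- The defining relations of the Leavitt path algebra. -/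
inductive LeavittRel (K : Type w) [Field K] {V : Type u} {W : Type v} (E : DirectedGraph V W) :
    FreeLeavitt K V W → FreeLeavitt K V W → Prop
  | V_self (v : V) : LeavittRel K E (vertex K v * vertex K v) (vertex K v)
  | V_ne (v v' : V) (h : v ≠ v') : LeavittRel K E (vertex K v * vertex K v') 0
  | E1_source (e : W) : LeavittRel K E (vertex K (E.s e) * edge K e) (edge K e)
  | E1_range (e : W) : LeavittRel K E (edge K e * vertex K (E.r e)) (edge K e)
  | E2_range (e : W) : LeavittRel K E (vertex K (E.r e) * ghost K e) (ghost K e)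
  | E2_source (e : W) : LeavittRel K E (ghost K e * vertex K (E.s e)) (ghost K e)
  | CK1_self (e : W) : LeavittRel K E (ghost K e * edge K e) (vertex K (E.r e))
  | CK1_ne (e f : W) (h : e ≠ f) : LeavittRel K E (ghost K e * edge K f) 0
  | CK2 (v : V) (hv : E.IsRegular v) :
      LeavittRel K E (vertex K v) (∑ e ∈ hv.2.toFinset, edge K e * ghost K e)

/-- The defining relations and their scalar multiples. A ring congruence of an algebra without
unit need not respect scalars, so the scalar multiples have to be listed among its generators. -/
inductive LeavittScalarRel (K : Type w) [Field K] {V : Type u} {W : Type v}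
    (E : DirectedGraph V W) : FreeLeavitt K V W → FreeLeavitt K V W → Prop
  | smul (k : K) {a b : FreeLeavitt K V W} (h : LeavittRel K E a b) :
      LeavittScalarRel K E (k • a) (k • b)

/-- The smallest congruence of the free algebra (for addition, multiplication and scalars) which
contains the defining relations. -/
noncomputable def leavittCon (K : Type w) [Field K] {V : Type u} {W : Type v} (E : DirectedGraph V W) :
    RingCon (FreeLeavitt K V W) :=
  ringConGen (LeavittScalarRel K E)

theorem leavittCon_smul (K : Type w) [Field K] {V : Type u} {W : Type v} (E : DirectedGraph V W)
    (k : K) {a b : FreeLeavitt K V W} (h : leavittCon K E a b) :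
    leavittCon K E (k • a) (k • b) := by
  have key : ∀ a b, RingConGen.Rel (LeavittScalarRel K E) a b →
      RingConGen.Rel (LeavittScalarRel K E) (k • a) (k • b) := by
    intro a b h
    induction h with
    | of x y h =>
      obtain ⟨l, h⟩ := h
      rw [smul_smul, smul_smul]
      exact .of _ _ (.smul _ h)
    | refl x => exact .refl _
    | symm _ ih => exact .symm ih
    | trans _ _ ih₁ ih₂ => exact .trans ih₁ ih₂
    | add _ _ ih₁ ih₂ => rw [smul_add, smul_add]; exact .add ih₁ ih₂
    | mul _ h ih₁ _ =>
      rw [← smul_mul_assoc, ← smul_mul_assoc]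
      exact .mul ih₁ h
  exact key a b h

/-- The Leavitt path algebra `L_K(E)`: the associative (not necessarily unital) `K`-algebra
generated by the vertices, edges and ghost edges of `E`, subject to (V), (E1), (E2), (CK1),
(CK2). -/
def LeavittPathAlgebra (K : Type w) [Field K] {V : Type u} {W : Type v} (E : DirectedGraph V W) :
    Type (max u v w) :=
  (leavittCon K E).Quotient

namespace LeavittPathAlgebra

variable (K : Type w) [Field K] {V : Type u} {W : Type v} (E : DirectedGraph V W)

noncomputable instance : NonUnitalRing (LeavittPathAlgebra K E) :=
  inferInstanceAs (NonUnitalRing (leavittCon K E).Quotient)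

/-- The quotient map from the free algebra. -/
noncomputable def mk (a : FreeLeavitt K V W) : LeavittPathAlgebra K E :=
  ((a : (leavittCon K E).Quotient))

theorem mk_surjective : Function.Surjective (mk K E) := Quotient.mk''_surjective

/-- The quotient map as an additive homomorphism. -/
noncomputable def mkAddHom : FreeLeavitt K V W →+ LeavittPathAlgebra K E where
  toFun := mk K E
  map_zero' := rfl
  map_add' _ _ := rfl

noncomputable instance : SMul K (LeavittPathAlgebra K E) where
  smul k := Quotient.map' (k • ·) fun _ _ h => leavittCon_smul K E k h

noncomputable instance : Module K (LeavittPathAlgebra K E) :=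
  Function.Surjective.module K (mkAddHom K E) (mk_surjective K E) fun _ _ => rfl

instance : IsScalarTower K (LeavittPathAlgebra K E) (LeavittPathAlgebra K E) where
  smul_assoc k x y := by
    obtain ⟨a, rfl⟩ := mk_surjective K E x
    obtain ⟨b, rfl⟩ := mk_surjective K E y
    exact congrArg (mk K E) (smul_mul_assoc k a b)

instance : SMulCommClass K (LeavittPathAlgebra K E) (LeavittPathAlgebra K E) where
  smul_comm k x y := by
    obtain ⟨a, rfl⟩ := mk_surjective K E x
    obtain ⟨b, rfl⟩ := mk_surjective K E y
    exact congrArg (mk K E) (mul_smul_comm k a b).symm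

/-- The Lie bracket `[a, b] = ab - ba`. -/
noncomputable instance : Bracket (LeavittPathAlgebra K E) (LeavittPathAlgebra K E) where
  bracket a b := a * b - b * a

theorem lie_def (a b : LeavittPathAlgebra K E) : ⁅a, b⁆ = a * b - b * a := rfl

noncomputable instance : LieRing (LeavittPathAlgebra K E) where
  add_lie _ _ _ := by simp only [lie_def, add_mul, mul_add]; abel
  lie_add _ _ _ := by simp only [lie_def, add_mul, mul_add]; abel
  lie_self _ := by simp only [lie_def, sub_self]
  leibniz_lie _ _ _ := by simp only [lie_def, mul_sub, sub_mul, mul_assoc]; abel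

/-- The Lie algebra `L_K(E)⁻` associated to the associative algebra `L_K(E)`. -/
noncomputable instance : LieAlgebra K (LeavittPathAlgebra K E) where
  lie_smul k a b := by simp only [lie_def, mul_smul_comm, smul_mul_assoc, smul_sub]

/-- `L_K(E)` is Lie solvable if the Lie algebra `L_K(E)⁻` is solvable. -/
def LieSolvable : Prop := LieAlgebra.IsSolvable (LeavittPathAlgebra K E)

/-- `L_K(E)` is locally Lie solvable if every finite-dimensional Lie subalgebra of `L_K(E)⁻` is
solvable. -/
def LocallyLieSolvable : Prop :=
  ∀ L : LieSubalgebra K (LeavittPathAlgebra K E), FiniteDimensional K L → LieAlgebra.IsSolvable L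

end LeavittPathAlgebra

/-!
For an edge `e` of an acyclic graph, `ee*`, `e`, `e*` and `r(e)` multiply like the four matrix units
of size two, so they define a Lie homomorphism `φₑ` from `M₂(K)`. By local solvability, a Lie
homomorphism from a finite-dimensional Lie algebra has solvable range, hence kills a term of the
derived series. Off the diagonal, the matrix units lie in every term when there are at least three
indices or `2` is invertible. A second edge ending at `r(e)`, or an edge ending at `s(e)`, would
enlarge the matrix units of `e` to size three, which forces `r(e) = 0`. Therefore the images of the
`φₑ` annihilate each other. Since their sum is an ideal modulo which the algebra is generated by
commuting vertices, the derived series is controlled by that of `M₂(K)`: either every `φₑ` is zero,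
or the characteristic is two and `M₂(K)` is solvable.
-/

attribute [local instance] LieRing.ofAssociativeRing

theorem apply_mem_of_mem_iSup {R M N P ι κ : Type*} [CommSemiring R] [AddCommMonoid M] [Module R M]
    [AddCommMonoid N] [Module R N] [AddCommMonoid P] [Module R P] (B : M →ₗ[R] N →ₗ[R] P)
    {p : ι → Submodule R M} {q : κ → Submodule R N} {S : Submodule R P}
    (h : ∀ i j, ∀ x ∈ p i, ∀ y ∈ q j, B x y ∈ S) {x : M} {y : N} (hx : x ∈ ⨆ i, p i)
    (hy : y ∈ ⨆ j, q j) : B x y ∈ S := by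
  have hle : Submodule.map₂ B (⨆ i, p i) (⨆ j, q j) ≤ S := by
    simp only [Submodule.map₂_iSup_left, Submodule.map₂_iSup_right]
    exact iSup_le fun j => iSup_le fun i => Submodule.map₂_le.mpr (h i j)
  exact hle (Submodule.apply_mem_map₂ B hx hy)

section DerivedSeries

variable {R L L' : Type*} [CommRing R] [LieRing L] [LieAlgebra R L] [LieRing L'] [LieAlgebra R L']

theorem exists_derivedSeries_le_ker (φ : L' →ₗ⁅R⁆ L) [LieAlgebra.IsSolvable φ.range] :
    ∃ k, LieAlgebra.derivedSeries R L' k ≤ φ.ker := by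
  obtain ⟨k, hk⟩ := LieAlgebra.IsSolvable.solvable R φ.range
  rw [← LieIdeal.derivedSeries_map_eq k φ.surjective_rangeRestrict, LieIdeal.map_eq_bot_iff] at hk
  refine ⟨k, fun x hx => ?_⟩
  exact congrArg Subtype.val (LieHom.mem_ker.mp (hk hx))

theorem lie_mem_derivedSeries_succ {n : ℕ} {x y : L} (hx : x ∈ LieAlgebra.derivedSeries R L n)
    (hy : y ∈ LieAlgebra.derivedSeries R L n) : ⁅x, y⁆ ∈ LieAlgebra.derivedSeries R L (n + 1) := by
  rw [LieAlgebra.derivedSeries_def, LieAlgebra.derivedSeriesOfIdeal_succ]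
  exact LieSubmodule.lie_mem_lie hx hy

theorem derivedSeries_succ_le {n : ℕ} {P : Submodule R L}
    (h : ∀ x ∈ LieAlgebra.derivedSeries R L n, ∀ y ∈ LieAlgebra.derivedSeries R L n, ⁅x, y⁆ ∈ P) :
    (LieAlgebra.derivedSeries R L (n + 1)).toSubmodule ≤ P := by
  rw [LieAlgebra.derivedSeries_def, LieAlgebra.derivedSeriesOfIdeal_succ,
    LieSubmodule.lieIdeal_oper_eq_linear_span', Submodule.span_le]
  rintro _ ⟨x, hx, y, hy, rfl⟩
  exact h x hx y hy

theorem derivedSeries_succ_le_iSup_map {ι : Type*} {φ : ι → L' →ₗ⁅R⁆ L}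
    (horth : Pairwise fun i j => ∀ x y, ⁅φ i x, φ j y⁆ = 0)
    (hlie : ∀ x y : L, ⁅x, y⁆ ∈ ⨆ i, (φ i).range.toSubmodule) (n : ℕ) :
    (LieAlgebra.derivedSeries R L (n + 1)).toSubmodule ≤
      ⨆ i, (LieAlgebra.derivedSeries R L' n).toSubmodule.map (φ i : L' →ₗ[R] L) := by
  refine derivedSeries_succ_le fun x hx y hy => ?_
  induction n generalizing x y with
  | zero =>
    convert hlie x y using 3 with i
    ext
    simp
  | succ n ih =>
    have hD := derivedSeries_succ_le ih
    refine apply_mem_of_mem_iSup (LieModule.toEnd R L L : L →ₗ[R] L →ₗ[R] L) ?_ (hD hx) (hD hy)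
    rintro i j _ ⟨a, ha, rfl⟩ _ ⟨b, hb, rfl⟩
    by_cases hij : i = j
    · subst hij
      refine Submodule.mem_iSup_of_mem i ⟨⁅a, b⁆, ?_, (φ i).map_lie a b⟩
      exact lie_mem_derivedSeries_succ ha hb
    · change ⁅φ i a, φ j b⁆ ∈ _
      exact (horth hij a b).symm ▸ Submodule.zero_mem _

theorem isSolvable_of_pairwise_lie_eq_zero {ι : Type*} {φ : ι → L' →ₗ⁅R⁆ L}
    (horth : Pairwise fun i j => ∀ x y, ⁅φ i x, φ j y⁆ = 0)
    (hlie : ∀ x y : L, ⁅x, y⁆ ∈ ⨆ i, (φ i).range.toSubmodule) {n : ℕ}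
    (hker : ∀ i, LieAlgebra.derivedSeries R L' n ≤ (φ i).ker) : LieAlgebra.IsSolvable L := by
  refine LieAlgebra.IsSolvable.mk (R := R) (k := n + 1) ?_
  rw [← LieSubmodule.toSubmodule_eq_bot, eq_bot_iff]
  refine (derivedSeries_succ_le_iSup_map horth hlie n).trans (iSup_le fun i => ?_)
  rintro _ ⟨x, hx, rfl⟩
  exact LieHom.mem_ker.mp (hker i hx)

end DerivedSeries

section MatrixLie

open Matrix LieAlgebra

variable (R : Type*) [CommRing R] {n : Type*} [Fintype n] [DecidableEq n]

theorem single_mem_derivedSeries_of_two_lt_card (hn : 2 < Fintype.card n) {i j : n} (hij : i ≠ j)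
    (k : ℕ) : single i j (1 : R) ∈ derivedSeries R (Matrix n n R) k := by
  induction k generalizing i j with
  | zero => exact LieSubmodule.mem_top _
  | succ k ih =>
    obtain ⟨l, -, hl⟩ := Finset.exists_mem_notMem_of_card_lt_card (s := {i, j}) (t := Finset.univ)
      (Finset.card_le_two.trans_lt hn)
    have hli : i ≠ l := by grind
    have hlj : l ≠ j := by grind
    have hlie : single i j (1 : R) = ⁅single i l (1 : R), single l j (1 : R)⁆ := by
      rw [Ring.lie_def, single_mul_single_same, single_mul_single_of_ne _ _ _ _ hij.symm, sub_zero,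
        one_mul]
    rw [hlie]
    exact lie_mem_derivedSeries_succ (ih hli) (ih hlj)

theorem single_mem_derivedSeries_of_invertible_two [Invertible (2 : R)] {i j : n} (hij : i ≠ j)
    (k : ℕ) : single i j (1 : R) ∈ derivedSeries R (Matrix n n R) k := by
  induction k with
  | zero => exact LieSubmodule.mem_top _
  | succ k ih =>
    have hlie : ⁅⁅single i j (1 : R), single j i (1 : R)⁆, single i j (1 : R)⁆ =
        (2 : R) • single i j (1 : R) := by
      rw [two_smul]
      simp [Ring.lie_def, sub_mul, mul_sub, hij.symm]
    rw [← invOf_smul_smul (2 : R) (single i j (1 : R)), ← hlie]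
    exact Submodule.smul_mem _ _ (lie_mem_derivedSeries_succ (lie_mem_left R _ _ _ _ ih) ih)

/-- In characteristic two, commutators in `M₂(R)` have equal diagonal entries, and commutators of
matrices with equal diagonal entries are scalar. -/
theorem derivedSeries_three_matrix_fin_two [CharP R 2] :
    derivedSeries R (Matrix (Fin 2) (Fin 2) R) 3 = ⊥ := by
  have h₁ : (derivedSeries R (Matrix (Fin 2) (Fin 2) R) 1).toSubmodule ≤
      LinearMap.ker (traceLinearMap (Fin 2) R R) := derivedSeries_succ_le fun x _ y _ =>
    matrix_trace_commutator_zero (Fin 2) R x y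
  have hdiag : ∀ {x}, x ∈ derivedSeries R (Matrix (Fin 2) (Fin 2) R) 1 → x 0 0 = x 1 1 := by
    intro x hx
    have htr : x 0 0 + x 1 1 = 0 := by simpa [trace_fin_two] using h₁ hx
    exact CharTwo.add_eq_zero.mp htr
  have h₂ : (derivedSeries R (Matrix (Fin 2) (Fin 2) R) 2).toSubmodule ≤ R ∙ 1 := by
    refine derivedSeries_succ_le fun x hx y hy => Submodule.mem_span_singleton.mpr
      ⟨x 0 1 * y 1 0 - y 0 1 * x 1 0, ?_⟩
    ext i j
    fin_cases i <;> fin_cases j <;>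
      simp [Ring.lie_def, mul_apply, Fin.sum_univ_two, hdiag hx, hdiag hy] <;>
      grind
  rw [← LieSubmodule.toSubmodule_eq_bot, eq_bot_iff]
  refine derivedSeries_succ_le fun x hx y _ => ?_
  obtain ⟨c, rfl⟩ := Submodule.mem_span_singleton.mp (h₂ hx)
  simp [Ring.lie_def]

end MatrixLie

section MatrixUnits

/-- Elements `a i`, `b i` and `w` for which the products `a i * b j` multiply like matrix units
indexed by `n` and `w` is the common value of the `b i * a i`. -/
structure IsMatrixFrame {n A : Type*} [NonUnitalSemiring A] (a b : n → A) (w : A) : Prop where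
  mul_self : ∀ i, b i * a i = w
  mul_of_ne : ∀ {i j}, i ≠ j → b i * a j = 0
  mul_right : ∀ i, a i * w = a i

/-- The linear map on matrices sending the matrix unit at `(i, j)` to `a i * b j`. -/
def matrixUnitMap (R : Type*) {n A : Type*} [Fintype n] [DecidableEq n] [CommSemiring R]
    [NonUnitalSemiring A] [Module R A] (a b : n → A) : Matrix n n R →ₗ[R] A :=
  Matrix.liftLinear R fun i j => LinearMap.toSpanSingleton R A (a i * b j)

section

variable {R n A : Type*} [Fintype n] [DecidableEq n] [CommSemiring R] [NonUnitalSemiring A]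
  [Module R A] {a b : n → A}

theorem matrixUnitMap_apply (M : Matrix n n R) :
    matrixUnitMap R a b M = ∑ i, ∑ j, M i j • (a i * b j) := by
  simp [matrixUnitMap, Matrix.liftLinear_apply]

theorem matrixUnitMap_single (i j : n) :
    matrixUnitMap R a b (Matrix.single i j 1) = a i * b j := by
  simp [matrixUnitMap]

variable [IsScalarTower R A A] [SMulCommClass R A A]

theorem mul_matrixUnitMap {x : A} {d : n → R} (h : ∀ i, x * a i = d i • a i) (M : Matrix n n R) :
    x * matrixUnitMap R a b M = matrixUnitMap R a b (Matrix.diagonal d * M) := by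
  simp only [matrixUnitMap_apply, Finset.mul_sum, mul_smul_comm, ← mul_assoc, h, smul_mul_assoc,
    smul_smul, Matrix.diagonal_mul, mul_comm (d _)]

theorem matrixUnitMap_mul {x : A} {d : n → R} (h : ∀ j, b j * x = d j • b j) (M : Matrix n n R) :
    matrixUnitMap R a b M * x = matrixUnitMap R a b (M * Matrix.diagonal d) := by
  simp only [matrixUnitMap_apply, Finset.sum_mul, smul_mul_assoc, mul_assoc, h, mul_smul_comm,
    smul_smul, Matrix.mul_diagonal]

theorem matrixUnitMap_mul_matrixUnitMap_eq_zero {a' b' : n → A} (h : ∀ i j, b i * a' j = 0)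
    (M N : Matrix n n R) : matrixUnitMap R a b M * matrixUnitMap R a' b' N = 0 := by
  have h' : ∀ i j k l, a i * b j * (a' k * b' l) = 0 := fun i j k l => by
    rw [mul_assoc, ← mul_assoc (b j), h, zero_mul, mul_zero]
  simp only [matrixUnitMap_apply, Finset.sum_mul_sum, smul_mul_smul_comm, h', smul_zero,
    Finset.sum_const_zero]

end

namespace IsMatrixFrame

theorem singleton {A : Type*} [NonUnitalSemiring A] {w : A} (hw : w * w = w) :
    IsMatrixFrame ![w] ![w] w where
  mul_self := by simpa using hw
  mul_of_ne hij := (hij (Subsingleton.elim _ _)).elim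
  mul_right := by simpa using hw

theorem cons {A : Type*} [NonUnitalSemiring A] {m : ℕ} {a b : Fin m → A} {w x y : A}
    (h : IsMatrixFrame a b w) (hyx : y * x = w) (hya : ∀ i, y * a i = 0) (hbx : ∀ i, b i * x = 0)
    (hxw : x * w = x) : IsMatrixFrame (Matrix.vecCons x a) (Matrix.vecCons y b) w where
  mul_self := Fin.cases hyx h.mul_self
  mul_of_ne {i j} hij := by
    cases i using Fin.cases <;> cases j using Fin.cases
    · exact (hij rfl).elim
    · exact hya _
    · exact hbx _
    · exact h.mul_of_ne fun hij' => hij (congrArg Fin.succ hij')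
  mul_right := Fin.cases hxw h.mul_right

theorem eq_zero_of_mul_eq_zero {n A : Type*} [NonUnitalSemiring A] {a b : n → A} {w : A}
    (h : IsMatrixFrame a b w) {i j : n} (hij : a i * b j = 0) : w = 0 := by
  calc w = b i * a i * w := by rw [mul_assoc, h.mul_right, h.mul_self]
    _ = b i * (a i * b j) * a j := by rw [← h.mul_self j]; simp only [mul_assoc]
    _ = 0 := by rw [hij, mul_zero, zero_mul]

variable {R n A : Type*} [Fintype n] [DecidableEq n] [CommSemiring R] [NonUnitalSemiring A]
  [Module R A] {a b : n → A} {w : A}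

theorem matrixUnitMap_eq_zero (h : IsMatrixFrame a b w) (hw : w = 0) :
    matrixUnitMap R a b = 0 := by
  have ha : ∀ i, a i = 0 := fun i => by rw [← h.mul_right i, hw, mul_zero]
  ext M
  simp only [matrixUnitMap_apply, ha, zero_mul, smul_zero, Finset.sum_const_zero,
    LinearMap.zero_apply]

theorem map_mul [IsScalarTower R A A] [SMulCommClass R A A] (h : IsMatrixFrame a b w)
    (M N : Matrix n n R) :
    matrixUnitMap R a b (M * N) = matrixUnitMap R a b M * matrixUnitMap R a b N := by
  have hcol : ∀ k, matrixUnitMap R a b M * a k = ∑ i, M i k • a i := fun k => by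
    rw [matrixUnitMap_apply, Finset.sum_mul]
    refine Finset.sum_congr rfl fun i _ => ?_
    rw [Finset.sum_mul, Finset.sum_eq_single_of_mem k (Finset.mem_univ k)]
    · rw [smul_mul_assoc, mul_assoc, h.mul_self, h.mul_right]
    · intro j _ hjk
      rw [smul_mul_assoc, mul_assoc, h.mul_of_ne hjk, mul_zero, smul_zero]
  calc matrixUnitMap R a b (M * N)
      = ∑ i, ∑ l, ∑ k, (M i k * N k l) • (a i * b l) := by
        simp only [matrixUnitMap_apply, Matrix.mul_apply, Finset.sum_smul]
    _ = ∑ k, ∑ l, ∑ i, (M i k * N k l) • (a i * b l) :=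
        Finset.sum_comm.trans
          ((Finset.sum_congr rfl fun _ _ => Finset.sum_comm).trans Finset.sum_comm)
    _ = ∑ k, ∑ l, N k l • (matrixUnitMap R a b M * (a k * b l)) := by
        simp only [← mul_assoc, hcol, Finset.sum_mul, Finset.smul_sum, smul_mul_assoc, smul_smul,
          mul_comm (N _ _)]
    _ = matrixUnitMap R a b M * matrixUnitMap R a b N := by
        simp only [matrixUnitMap_apply (a := a) (b := b) N, Finset.mul_sum, mul_smul_comm]

end IsMatrixFrame

end MatrixUnits

namespace DirectedGraph.Acyclic

variable {V : Type u} {W : Type v} {E : DirectedGraph V W}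

theorem range_ne_source (hE : E.Acyclic) (e : W) : E.r e ≠ E.s e := fun h =>
  hE (E.s e) [e] ⟨⟨by simp, by simp⟩, by simp, by simp [h]⟩

theorem range_ne_source_of_path (hE : E.Acyclic) {e f : W} (hef : E.r e = E.s f) :
    E.r f ≠ E.s e := fun h =>
  hE (E.s e) [e, f] ⟨⟨by simp, by simp [hef]⟩, by simp, by simp [h]⟩

end DirectedGraph.Acyclic

namespace LeavittPathAlgebra

variable {K : Type w} [Field K] {V : Type u} {W : Type v} {E : DirectedGraph V W}

section Generators

variable (K E)

/-- The image of a generator in the Leavitt path algebra. -/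
noncomputable def gen (g : LeavittGen V W) : LeavittPathAlgebra K E := mk K E (FreeLeavitt.gen K g)

/-- The vertex `v` as an element of the Leavitt path algebra. -/
noncomputable abbrev vertex (v : V) : LeavittPathAlgebra K E := gen K E (.vertex v)

/-- The edge `e` as an element of the Leavitt path algebra. -/
noncomputable abbrev edge (e : W) : LeavittPathAlgebra K E := gen K E (.edge e)

/-- The ghost edge `e*` as an element of the Leavitt path algebra. -/
noncomputable abbrev ghost (e : W) : LeavittPathAlgebra K E := gen K E (.ghost e)

variable {K E}

theorem mk_eq_of_rel {a b : FreeLeavitt K V W} (h : LeavittRel K E a b) : mk K E a = mk K E b :=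
  (RingCon.eq _).2 (.of _ _ (by simpa using LeavittScalarRel.smul (1 : K) h))

theorem vertex_mul_self (v : V) : vertex K E v * vertex K E v = vertex K E v :=
  mk_eq_of_rel (.V_self v)

theorem vertex_mul_of_ne {v v' : V} (h : v ≠ v') : vertex K E v * vertex K E v' = 0 :=
  mk_eq_of_rel (.V_ne v v' h)

theorem source_mul_edge (e : W) : vertex K E (E.s e) * edge K E e = edge K E e :=
  mk_eq_of_rel (.E1_source e)

theorem edge_mul_range (e : W) : edge K E e * vertex K E (E.r e) = edge K E e :=
  mk_eq_of_rel (.E1_range e)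

theorem range_mul_ghost (e : W) : vertex K E (E.r e) * ghost K E e = ghost K E e :=
  mk_eq_of_rel (.E2_range e)

theorem ghost_mul_source (e : W) : ghost K E e * vertex K E (E.s e) = ghost K E e :=
  mk_eq_of_rel (.E2_source e)

theorem ghost_mul_edge_self (e : W) : ghost K E e * edge K E e = vertex K E (E.r e) :=
  mk_eq_of_rel (.CK1_self e)

theorem ghost_mul_edge_of_ne {e f : W} (h : e ≠ f) : ghost K E e * edge K E f = 0 :=
  mk_eq_of_rel (.CK1_ne e f h)

theorem mul_eq_zero_of_ne {x y : LeavittPathAlgebra K E} {u v : V} (hx : x * vertex K E u = x)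
    (hy : vertex K E v * y = y) (huv : u ≠ v) : x * y = 0 := by
  rw [← hx, ← hy, mul_assoc, ← mul_assoc (vertex K E u), vertex_mul_of_ne huv, zero_mul, mul_zero]

theorem exists_vertex_mul_eq_smul {x : LeavittPathAlgebra K E} {u : V}
    (hx : vertex K E u * x = x) (v : V) : ∃ c : K, vertex K E v * x = c • x := by
  obtain rfl | hvu := eq_or_ne v u
  · exact ⟨1, by rw [hx, one_smul]⟩
  · exact ⟨0, by rw [mul_eq_zero_of_ne (vertex_mul_self v) hx hvu, zero_smul]⟩

theorem exists_mul_vertex_eq_smul {x : LeavittPathAlgebra K E} {u : V}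
    (hx : x * vertex K E u = x) (v : V) : ∃ c : K, x * vertex K E v = c • x := by
  obtain rfl | huv := eq_or_ne u v
  · exact ⟨1, by rw [hx, one_smul]⟩
  · exact ⟨0, by rw [mul_eq_zero_of_ne hx (vertex_mul_self v) huv, zero_smul]⟩

theorem gen_induction {p : LeavittPathAlgebra K E → Prop} (zero : p 0)
    (add : ∀ x y, p x → p y → p (x + y)) (smul : ∀ (c : K) x, p x → p (c • x))
    (gen_mul : ∀ g x, p x → p (gen K E g * x)) (gen : ∀ g, p (gen K E g))
    (x : LeavittPathAlgebra K E) : p x := by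
  have monomial (m : FreeSemigroup (LeavittGen V W)) : p (mk K E (MonoidAlgebra.single m 1)) := by
    induction m using FreeSemigroup.recOnMul with
    | ih1 g => exact gen g
    | ih2 g m _ ih =>
      have hmul : mk K E (MonoidAlgebra.single (FreeSemigroup.of g * m) 1) =
          LeavittPathAlgebra.gen K E g * mk K E (MonoidAlgebra.single m 1) := by
        rw [← one_mul (1 : K), ← MonoidAlgebra.single_mul_single, one_mul]
        rfl
      exact hmul ▸ gen_mul g _ ih
  obtain ⟨a, rfl⟩ := mk_surjective K E x
  induction a using MonoidAlgebra.induction_linear with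
  | zero => exact zero
  | add a b ha hb => exact add _ _ ha hb
  | single m c =>
  have hsmul : mk K E (MonoidAlgebra.single m c) =
      c • mk K E (MonoidAlgebra.single m 1) := by
    rw [← mul_one c, ← smul_eq_mul, ← MonoidAlgebra.smul_single, smul_eq_mul, mul_one]
    rfl
  exact hsmul ▸ smul c _ (monomial m)

theorem mul_mem_of_mul_gen_mem {I : Submodule K (LeavittPathAlgebra K E)}
    (h : ∀ x ∈ I, ∀ g, x * gen K E g ∈ I) {x : LeavittPathAlgebra K E} (hx : x ∈ I)
    (y : LeavittPathAlgebra K E) : x * y ∈ I := by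
  induction y using gen_induction generalizing x with
  | zero => rw [mul_zero]; exact I.zero_mem
  | add y z hy hz => rw [mul_add]; exact I.add_mem (hy hx) (hz hx)
  | smul c y hy => rw [mul_smul_comm]; exact I.smul_mem c (hy hx)
  | gen g => exact h x hx g
  | gen_mul g y hy => rw [← mul_assoc]; exact hy (h x hx g)

theorem lie_mem_of_lie_gen_mem {I : Submodule K (LeavittPathAlgebra K E)}
    (hleft : ∀ x ∈ I, ∀ g, gen K E g * x ∈ I) (hright : ∀ x ∈ I, ∀ g, x * gen K E g ∈ I)
    (hlie : ∀ g g', ⁅gen K E g, gen K E g'⁆ ∈ I) (x y : LeavittPathAlgebra K E) : ⁅x, y⁆ ∈ I := by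
  have hgen (g) (y : LeavittPathAlgebra K E) : ⁅gen K E g, y⁆ ∈ I := by
    induction y using gen_induction with
    | zero => rw [lie_zero]; exact I.zero_mem
    | add y z hy hz => rw [lie_add]; exact I.add_mem hy hz
    | smul c y hy => rw [lie_smul]; exact I.smul_mem c hy
    | gen g' => exact hlie g g'
    | gen_mul g' y hy =>
      have hleibniz : ⁅gen K E g, gen K E g' * y⁆ =
          ⁅gen K E g, gen K E g'⁆ * y + gen K E g' * ⁅gen K E g, y⁆ := by
        simp only [lie_def, sub_mul, mul_sub, mul_assoc]; abel
      exact hleibniz ▸ I.add_mem (mul_mem_of_mul_gen_mem hright (hlie g g') y) (hleft _ hy g')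
  induction x using gen_induction with
  | zero => rw [zero_lie]; exact I.zero_mem
  | add x z hx hz => rw [add_lie]; exact I.add_mem hx hz
  | smul c x hx => rw [smul_lie]; exact I.smul_mem c hx
  | gen g => exact hgen g y
  | gen_mul g x hx =>
    have hleibniz : ⁅gen K E g * x, y⁆ = gen K E g * ⁅x, y⁆ + ⁅gen K E g, y⁆ * x := by
      simp only [lie_def, sub_mul, mul_sub, mul_assoc]; abel
    exact hleibniz ▸ I.add_mem (hleft _ hx g) (mul_mem_of_mul_gen_mem hright (hgen g y) x)

end Generators

section Frames

open Matrix

variable {n : Type*} [Fintype n] [DecidableEq n] {a b : n → LeavittPathAlgebra K E}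
  {x : LeavittPathAlgebra K E}

/-- The Lie algebra homomorphism from matrices defined by a matrix frame. -/
noncomputable def matrixLieHom (h : IsMatrixFrame a b x) :
    Matrix n n K →ₗ⁅K⁆ LeavittPathAlgebra K E where
  __ := matrixUnitMap K a b
  map_lie' {M N} := by
    change matrixUnitMap K a b _ = ⁅matrixUnitMap K a b M, matrixUnitMap K a b N⁆
    rw [Ring.lie_def, map_sub, h.map_mul, h.map_mul, lie_def]

theorem matrixLieHom_apply (h : IsMatrixFrame a b x) (M : Matrix n n K) :
    matrixLieHom h M = matrixUnitMap K a b M := rfl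

theorem eq_zero_of_isMatrixFrame (hL : LocallyLieSolvable K E) (h : IsMatrixFrame a b x) {i j : n}
    (hij : ∀ k, single i j 1 ∈ LieAlgebra.derivedSeries K (Matrix n n K) k) : x = 0 := by
  have : FiniteDimensional K (matrixLieHom h).range :=
    inferInstanceAs (FiniteDimensional K
      (LinearMap.range (matrixLieHom h : Matrix n n K →ₗ[K] LeavittPathAlgebra K E)))
  have := hL (matrixLieHom h).range this
  obtain ⟨k, hk⟩ := exists_derivedSeries_le_ker (matrixLieHom h)
  have hker : matrixLieHom h (single i j 1) = 0 := LieHom.mem_ker.mp (hk (hij k))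
  rw [matrixLieHom_apply, matrixUnitMap_single] at hker
  exact h.eq_zero_of_mul_eq_zero hker

theorem isMatrixFrame_edge (hE : E.Acyclic) (e : W) :
    IsMatrixFrame ![edge K E e, vertex K E (E.r e)] ![ghost K E e, vertex K E (E.r e)]
      (vertex K E (E.r e)) := by
  refine (IsMatrixFrame.singleton (vertex_mul_self _)).cons (ghost_mul_edge_self e) ?_ ?_
    (edge_mul_range e)
  · simpa using
      mul_eq_zero_of_ne (ghost_mul_source e) (vertex_mul_self _) (hE.range_ne_source e).symm
  · simpa using mul_eq_zero_of_ne (vertex_mul_self _) (source_mul_edge e) (hE.range_ne_source e)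

theorem vertex_range_eq_zero_of_path (hE : E.Acyclic) (hL : LocallyLieSolvable K E) {e f : W}
    (hef : E.r e = E.s f) : vertex K E (E.r f) = 0 := by
  have hsource : E.s e ≠ E.s f := hef ▸ (hE.range_ne_source e).symm
  have hrange : E.r f ≠ E.s e := hE.range_ne_source_of_path hef
  have hx : vertex K E (E.s e) * (edge K E e * edge K E f) = edge K E e * edge K E f := by
    rw [← mul_assoc, source_mul_edge]
  have hy : ghost K E f * ghost K E e * vertex K E (E.s e) = ghost K E f * ghost K E e := by
    rw [mul_assoc, ghost_mul_source]
  have hyx : ghost K E f * ghost K E e * (edge K E e * edge K E f) = vertex K E (E.r f) := by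
    rw [mul_assoc, ← mul_assoc (ghost K E e), ghost_mul_edge_self, hef, source_mul_edge,
      ghost_mul_edge_self]
  have hframe := (isMatrixFrame_edge (K := K) hE f).cons hyx
    (Fin.forall_fin_two.mpr ⟨mul_eq_zero_of_ne hy (source_mul_edge f) hsource,
      mul_eq_zero_of_ne hy (vertex_mul_self _) hrange.symm⟩)
    (Fin.forall_fin_two.mpr ⟨mul_eq_zero_of_ne (ghost_mul_source f) hx hsource.symm,
      mul_eq_zero_of_ne (vertex_mul_self _) hx hrange⟩)
    (by rw [mul_assoc, edge_mul_range])
  exact eq_zero_of_isMatrixFrame hL hframe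
    (single_mem_derivedSeries_of_two_lt_card K (by simp) (zero_ne_one (α := Fin 3)))

theorem vertex_range_eq_zero_of_ne (hE : E.Acyclic) (hL : LocallyLieSolvable K E) {e f : W}
    (hne : e ≠ f) (hef : E.r e = E.r f) : vertex K E (E.r f) = 0 := by
  have hrange : E.r f ≠ E.s e := hef ▸ hE.range_ne_source e
  have hframe := (isMatrixFrame_edge (K := K) hE f).cons (hef ▸ ghost_mul_edge_self e)
    (Fin.forall_fin_two.mpr ⟨ghost_mul_edge_of_ne hne,
      mul_eq_zero_of_ne (ghost_mul_source e) (vertex_mul_self _) hrange.symm⟩)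
    (Fin.forall_fin_two.mpr ⟨ghost_mul_edge_of_ne hne.symm,
      mul_eq_zero_of_ne (vertex_mul_self _) (source_mul_edge e) hrange⟩)
    (hef ▸ edge_mul_range e)
  exact eq_zero_of_isMatrixFrame hL hframe
    (single_mem_derivedSeries_of_two_lt_card K (by simp) (zero_ne_one (α := Fin 3)))

theorem vertex_range_eq_zero_of_two_ne_zero (hE : E.Acyclic) (hL : LocallyLieSolvable K E)
    (h2 : (2 : K) ≠ 0) (e : W) : vertex K E (E.r e) = 0 :=
  have := invertibleOfNonzero h2
  eq_zero_of_isMatrixFrame hL (isMatrixFrame_edge hE e)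
    (single_mem_derivedSeries_of_invertible_two K (zero_ne_one (α := Fin 2)))

end Frames

section EdgeMatrices

variable (hE : E.Acyclic)

/-- The Lie algebra homomorphism sending the matrix units of `M₂(K)` to `ee*`, `e`, `e*` and
`r(e)`. -/
noncomputable def edgeLieHom (e : W) : Matrix (Fin 2) (Fin 2) K →ₗ⁅K⁆ LeavittPathAlgebra K E :=
  matrixLieHom (isMatrixFrame_edge hE e)

theorem edgeLieHom_single_zero_one (e : W) :
    edgeLieHom hE e (Matrix.single 0 1 1) = edge K E e :=
  (matrixUnitMap_single (n := Fin 2) 0 1).trans (edge_mul_range e)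

theorem edgeLieHom_single_one_zero (e : W) :
    edgeLieHom hE e (Matrix.single 1 0 1) = ghost K E e :=
  (matrixUnitMap_single (n := Fin 2) 1 0).trans (range_mul_ghost e)

variable (K) in
/-- The span of the elements `ee*`, `e`, `e*` and `r(e)` for all edges `e`. -/
noncomputable def edgeSpan : Submodule K (LeavittPathAlgebra K E) :=
  ⨆ e, (edgeLieHom hE e).range.toSubmodule

theorem edgeLieHom_mem_edgeSpan (e : W) (M : Matrix (Fin 2) (Fin 2) K) :
    edgeLieHom hE e M ∈ edgeSpan K hE :=
  Submodule.mem_iSup_of_mem e ⟨M, rfl⟩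

theorem edge_mem_edgeSpan (e : W) : edge K E e ∈ edgeSpan K hE :=
  edgeLieHom_single_zero_one (K := K) hE e ▸ edgeLieHom_mem_edgeSpan hE e _

theorem ghost_mem_edgeSpan (e : W) : ghost K E e ∈ edgeSpan K hE :=
  edgeLieHom_single_one_zero (K := K) hE e ▸ edgeLieHom_mem_edgeSpan hE e _

theorem vertex_mul_mem_edgeSpan (v : V) {x : LeavittPathAlgebra K E} (hx : x ∈ edgeSpan K hE) :
    vertex K E v * x ∈ edgeSpan K hE := by
  suffices hle : edgeSpan K hE ≤ (edgeSpan K hE).comap (LinearMap.mulLeft K (vertex K E v)) from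
    hle hx
  refine iSup_le fun e => ?_
  rintro _ ⟨M, rfl⟩
  have hsmul : ∀ i, ∃ c : K, vertex K E v * ![edge K E e, vertex K E (E.r e)] i =
      c • ![edge K E e, vertex K E (E.r e)] i := Fin.forall_fin_two.mpr
    ⟨exists_vertex_mul_eq_smul (source_mul_edge e) v,
      exists_vertex_mul_eq_smul (vertex_mul_self _) v⟩
  choose d hd using hsmul
  change vertex K E v * edgeLieHom hE e M ∈ edgeSpan K hE
  exact mul_matrixUnitMap hd M ▸ edgeLieHom_mem_edgeSpan hE e _

theorem mul_vertex_mem_edgeSpan (v : V) {x : LeavittPathAlgebra K E} (hx : x ∈ edgeSpan K hE) :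
    x * vertex K E v ∈ edgeSpan K hE := by
  suffices hle : edgeSpan K hE ≤ (edgeSpan K hE).comap (LinearMap.mulRight K (vertex K E v)) from
    hle hx
  refine iSup_le fun e => ?_
  rintro _ ⟨M, rfl⟩
  have hsmul : ∀ i, ∃ c : K, ![ghost K E e, vertex K E (E.r e)] i * vertex K E v =
      c • ![ghost K E e, vertex K E (E.r e)] i := Fin.forall_fin_two.mpr
    ⟨exists_mul_vertex_eq_smul (ghost_mul_source e) v,
      exists_mul_vertex_eq_smul (vertex_mul_self _) v⟩
  choose d hd using hsmul
  change edgeLieHom hE e M * vertex K E v ∈ edgeSpan K hE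
  exact matrixUnitMap_mul hd M ▸ edgeLieHom_mem_edgeSpan hE e _

variable (hL : LocallyLieSolvable K E)
include hL

theorem edgeLieHom_mul_eq_zero {e f : W} (hef : e ≠ f) (M N : Matrix (Fin 2) (Fin 2) K) :
    edgeLieHom hE e M * edgeLieHom hE f N = 0 := by
  have hghost_range : ghost K E e * vertex K E (E.r f) = 0 := by
    by_cases h : E.r f = E.s e
    · rw [← range_mul_ghost, vertex_range_eq_zero_of_path hE hL h, zero_mul, zero_mul]
    · exact mul_eq_zero_of_ne (ghost_mul_source e) (vertex_mul_self _) (Ne.symm h)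
  have hrange_edge : vertex K E (E.r e) * edge K E f = 0 := by
    by_cases h : E.r e = E.s f
    · rw [← edge_mul_range, vertex_range_eq_zero_of_path hE hL h, mul_zero, mul_zero]
    · exact mul_eq_zero_of_ne (vertex_mul_self _) (source_mul_edge f) h
  have hrange_range : vertex K E (E.r e) * vertex K E (E.r f) = 0 := by
    by_cases h : E.r e = E.r f
    · rw [vertex_range_eq_zero_of_ne hE hL hef h, mul_zero]
    · exact vertex_mul_of_ne h
  refine matrixUnitMap_mul_matrixUnitMap_eq_zero ?_ M N
  exact Fin.forall_fin_two.mpr ⟨Fin.forall_fin_two.mpr ⟨ghost_mul_edge_of_ne hef, hghost_range⟩,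
    Fin.forall_fin_two.mpr ⟨hrange_edge, hrange_range⟩⟩

theorem mul_mem_edgeSpan {x y : LeavittPathAlgebra K E} (hx : x ∈ edgeSpan K hE)
    (hy : y ∈ edgeSpan K hE) : x * y ∈ edgeSpan K hE := by
  refine apply_mem_of_mem_iSup (LinearMap.mul K (LeavittPathAlgebra K E)) ?_ hx hy
  rintro e f _ ⟨M, rfl⟩ _ ⟨N, rfl⟩
  change edgeLieHom hE e M * edgeLieHom hE f N ∈ edgeSpan K hE
  obtain rfl | hef := eq_or_ne e f
  · exact (isMatrixFrame_edge (K := K) hE e).map_mul M N ▸ edgeLieHom_mem_edgeSpan hE e _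
  · exact (edgeLieHom_mul_eq_zero hE hL hef M N).symm ▸ Submodule.zero_mem _

theorem gen_mul_mem_edgeSpan (g : LeavittGen V W) {x : LeavittPathAlgebra K E}
    (hx : x ∈ edgeSpan K hE) : gen K E g * x ∈ edgeSpan K hE :=
  match g with
  | .vertex v => vertex_mul_mem_edgeSpan hE v hx
  | .edge e => mul_mem_edgeSpan hE hL (edge_mem_edgeSpan hE e) hx
  | .ghost e => mul_mem_edgeSpan hE hL (ghost_mem_edgeSpan hE e) hx

theorem mul_gen_mem_edgeSpan (g : LeavittGen V W) {x : LeavittPathAlgebra K E}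
    (hx : x ∈ edgeSpan K hE) : x * gen K E g ∈ edgeSpan K hE :=
  match g with
  | .vertex v => mul_vertex_mem_edgeSpan hE v hx
  | .edge e => mul_mem_edgeSpan hE hL hx (edge_mem_edgeSpan hE e)
  | .ghost e => mul_mem_edgeSpan hE hL hx (ghost_mem_edgeSpan hE e)

theorem lie_mem_edgeSpan (x y : LeavittPathAlgebra K E) : ⁅x, y⁆ ∈ edgeSpan K hE := by
  refine lie_mem_of_lie_gen_mem (fun x hx g => gen_mul_mem_edgeSpan hE hL g hx)
    (fun x hx g => mul_gen_mem_edgeSpan hE hL g hx) (fun g g' => ?_) x y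
  have hleft (h : gen K E g ∈ edgeSpan K hE) : ⁅gen K E g, gen K E g'⁆ ∈ edgeSpan K hE :=
    Submodule.sub_mem _ (mul_gen_mem_edgeSpan hE hL g' h) (gen_mul_mem_edgeSpan hE hL g' h)
  have hright (h : gen K E g' ∈ edgeSpan K hE) : ⁅gen K E g, gen K E g'⁆ ∈ edgeSpan K hE :=
    Submodule.sub_mem _ (gen_mul_mem_edgeSpan hE hL g h) (mul_gen_mem_edgeSpan hE hL g h)
  match g, g' with
  | .edge e, _ => exact hleft (edge_mem_edgeSpan hE e)
  | .ghost e, _ => exact hleft (ghost_mem_edgeSpan hE e)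
  | .vertex _, .edge e => exact hright (edge_mem_edgeSpan hE e)
  | .vertex _, .ghost e => exact hright (ghost_mem_edgeSpan hE e)
  | .vertex v, .vertex v' =>
    have hcomm : ⁅vertex K E v, vertex K E v'⁆ = 0 := by
      obtain rfl | h := eq_or_ne v v'
      · exact lie_self _
      · rw [lie_def, vertex_mul_of_ne h, vertex_mul_of_ne h.symm, sub_zero]
    exact hcomm ▸ Submodule.zero_mem _

theorem derivedSeries_three_le_ker_edgeLieHom (e : W) :
    LieAlgebra.derivedSeries K (Matrix (Fin 2) (Fin 2) K) 3 ≤ (edgeLieHom hE e).ker := by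
  by_cases h2 : (2 : K) = 0
  · have : CharP K 2 := CharTwo.of_one_ne_zero_of_two_eq_zero one_ne_zero h2
    exact (derivedSeries_three_matrix_fin_two K).trans_le bot_le
  · intro M _
    exact LinearMap.congr_fun ((isMatrixFrame_edge hE e).matrixUnitMap_eq_zero
      (vertex_range_eq_zero_of_two_ne_zero hE hL h2 e)) M

end EdgeMatrices

end LeavittPathAlgebra

theorem theorem4p8 {V : Type u} {W : Type v} (E : DirectedGraph V W) (hE : E.Acyclic)
    (K : Type w) [Field K] (h : LeavittPathAlgebra.LocallyLieSolvable K E) :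
    LeavittPathAlgebra.LieSolvable K E := by
  have horth : Pairwise fun e f => ∀ M N : Matrix (Fin 2) (Fin 2) K,
      ⁅LeavittPathAlgebra.edgeLieHom hE e M, LeavittPathAlgebra.edgeLieHom hE f N⁆ = 0 :=
    fun e f hef M N => by
      rw [LeavittPathAlgebra.lie_def, LeavittPathAlgebra.edgeLieHom_mul_eq_zero hE h hef,
        LeavittPathAlgebra.edgeLieHom_mul_eq_zero hE h hef.symm, sub_zero]
  exact isSolvable_of_pairwise_lie_eq_zero horth (LeavittPathAlgebra.lie_mem_edgeSpan hE h)
    (LeavittPathAlgebra.derivedSeries_three_le_ker_edgeLieHom hE h)
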